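/- Let $N\ge 5$ and $2^{**}=\frac{2N}{N-4}$. Let $V:(0,\infty)\to[0,\infty]$ be measurable with $V\in L^1_{\mathrm{loc}}((0,\infty))$, and let $K:(0,\infty)\to(0,\infty)$ be measurable with $K\in L^s_{\mathrm{loc}}((0,\infty))$ for some $s>1$. Let $D^{2,2}(\mathbb{R}^N)$ be the space of all $u\in L^{2^{**}}(\mathbb{R}^N)$ whose weak second partial derivatives all belong to $L^2(\mathbb{R}^N)$, let $H^2_{V,r}$ be the set of radial $u\in D^{2,2}(\mathbb{R}^N)$ with $\int_{\mathbb{R}^N}V(|x|)u^2\,dx<\infty$, and put $$\|u\|=\Big(\int_{\mathbb{R}^N}\big(|\Delta u|^2+V(|x|)u^2\big)\,dx\Big)^{1/2}.$$ For $q>1$ and $R>0$ define, with $B_R=\{x\in\mathbb{R}^N:|x|<R\}$, $$\mathcal{R}_0(q,R)=\sup\Big\{\int_{B_R}K(|x|)\,|u|^{q-1}|h|\,dx \;:\; u,h\in H^2_{V,r},\ \|u\|=\|h\|=1\Big\}\in[0,\infty].$$ Assume that for some $R_1>0$ we have $V(r)<\infty$ for almost every $r\in(0,R_1)$ and $$\operatorname*{ess\,sup}_{r\in(0,R_1)}\frac{K(r)}{r^{\alpha_0}V(r)^{\beta_0}}<\infty$$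 for some $0\le\beta_0\le1$ and some real $\alpha_0>\alpha^*(\beta_0):=\max\{4\beta_0-2-\tfrac N2,\,-(1-\beta_0)N\}$ (the quotient is $+\infty$ where its denominator vanishes, and $V^{0}=1$). Then $$\lim_{R\to0^+}\mathcal{R}_0(q_1,R)=0$$ for every $q_1\in\mathbb{R}$ with $\max\{1,2\beta_0\}<q_1<q^*(\alpha_0,\beta_0):=\dfrac{2(\alpha_0-4\beta_0+N)}{N-4}$. -/

import Mathlib

open MeasureTheory Filter Topology Set
open scoped ENNReal

noncomputable section

/-- Assumption (V): `V : (0,∞) → [0,∞]` is Lebesgue measurable and belongs to `L¹_loc((0,∞))`,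
i.e. it is integrable on every compact subset of the open half line. (`V` is a function on `ℝ`
of which only the values on `(0,∞)` are used.) -/
def AssumptionV (V : ℝ → ℝ≥0∞) : Prop :=
  AEMeasurable V (volume.restrict (Ioi 0)) ∧
    ∀ k : Set ℝ, IsCompact k → k ⊆ Ioi 0 → ∫⁻ r in k, V r < ∞

/-- Assumption (K): `K : (0,∞) → (0,∞)` is Lebesgue measurable and belongs to `L^s_loc((0,∞))`
for some `s > 1`. -/
def AssumptionK (K : ℝ → ℝ) : Prop :=
  AEMeasurable K (volume.restrict (Ioi 0)) ∧ (∀ r : ℝ, 0 < r → 0 < K r) ∧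
    ∃ s : ℝ≥0∞, 1 < s ∧
      ∀ k : Set ℝ, IsCompact k → k ⊆ Ioi 0 → MemLp K s (volume.restrict k)

/-- `w` is the weak (distributional) second partial derivative `∂ᵢ∂ⱼ u` on `ℝᴺ`. -/
def HasWeakSecondPartial {N : ℕ} (i j : Fin N) (u w : EuclideanSpace ℝ (Fin N) → ℝ) : Prop :=
  LocallyIntegrable u ∧ LocallyIntegrable w ∧
    ∀ φ : EuclideanSpace ℝ (Fin N) → ℝ, ContDiff ℝ ((⊤ : ℕ∞) : WithTop ℕ∞) φ → HasCompactSupport φ →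
      ∫ x, u x * iteratedFDeriv ℝ 2 φ x ![EuclideanSpace.single i 1, EuclideanSpace.single j 1]
        = ∫ x, w x * φ x

open Classical in
/-- The weak second partial derivative `∂ᵢ∂ⱼ u`, unique up to null sets when it exists
(and `0` by convention otherwise). -/
def weakSecondPartial {N : ℕ} (i j : Fin N) (u : EuclideanSpace ℝ (Fin N) → ℝ) :
    EuclideanSpace ℝ (Fin N) → ℝ :=
  if h : ∃ w, HasWeakSecondPartial i j u w then h.choose else 0

/-- The weak Laplacian `Δu = ∑ᵢ ∂ᵢ∂ᵢ u`. -/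
def weakLaplacian {N : ℕ} (u : EuclideanSpace ℝ (Fin N) → ℝ) (x : EuclideanSpace ℝ (Fin N)) : ℝ :=
  ∑ i : Fin N, weakSecondPartial i i u x

/-- The critical exponent `2** = 2N/(N-4)`. -/
def critExponent (N : ℕ) : ℝ≥0∞ := ENNReal.ofReal (2 * N / (N - 4))

/-- `u ∈ D^{2,2}(ℝᴺ)`: `u ∈ L^{2**}(ℝᴺ)` and all its weak second partial derivatives
are in `L²(ℝᴺ)`. -/
def MemD22 {N : ℕ} (u : EuclideanSpace ℝ (Fin N) → ℝ) : Prop :=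
  MemLp u (critExponent N) ∧
    ∀ i j : Fin N, ∃ w, HasWeakSecondPartial i j u w ∧ MemLp w 2

/-- `u` is (almost everywhere equal to) a function of `|x|`. -/
def IsRadial {N : ℕ} (u : EuclideanSpace ℝ (Fin N) → ℝ) : Prop :=
  ∃ v : ℝ → ℝ, ∀ᵐ x : EuclideanSpace ℝ (Fin N), u x = v ‖x‖

/-- `u ∈ H²_V(ℝᴺ)`. -/
def MemH2V {N : ℕ} (V : ℝ → ℝ≥0∞) (u : EuclideanSpace ℝ (Fin N) → ℝ) : Prop :=
  MemD22 u ∧ ∫⁻ x, V ‖x‖ * ‖u x‖ₑ ^ 2 < ∞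

/-- `u ∈ H²_{V,r}(ℝᴺ)`, the radial subspace. -/
def MemH2Vr {N : ℕ} (V : ℝ → ℝ≥0∞) (u : EuclideanSpace ℝ (Fin N) → ℝ) : Prop :=
  MemH2V V u ∧ IsRadial u

/-- The norm `‖u‖ = (∫ |Δu|² + V(|x|)|u|² dx)^{1/2}` of `H²_V(ℝᴺ)`. -/
def normH2V {N : ℕ} (V : ℝ → ℝ≥0∞) (u : EuclideanSpace ℝ (Fin N) → ℝ) : ℝ≥0∞ :=
  (∫⁻ x, (‖weakLaplacian u x‖ₑ ^ 2 + V ‖x‖ * ‖u x‖ₑ ^ 2)) ^ (1 / 2 : ℝ)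

/-- `R₀(q,R)`: the supremum of `∫_{B_R} K(|x|)|u|^{q-1}|h| dx` over all `u, h ∈ H²_{V,r}(ℝᴺ)`
with `‖u‖ = ‖h‖ = 1`, as an element of `[0,∞]`. -/
def calR0 (N : ℕ) (V : ℝ → ℝ≥0∞) (K : ℝ → ℝ) (q R : ℝ) : ℝ≥0∞ :=
  ⨆ (u : EuclideanSpace ℝ (Fin N) → ℝ) (h : EuclideanSpace ℝ (Fin N) → ℝ)
    (_ : MemH2Vr V u ∧ MemH2Vr V h ∧ normH2V V u = 1 ∧ normH2V V h = 1),
    ∫⁻ x in Metric.ball 0 R, ENNReal.ofReal (K ‖x‖) * ‖u x‖ₑ ^ (q - 1) * ‖h x‖ₑ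

/-- `α*(β) = max {4β - 2 - N/2, -(1-β)N}`. -/
def alphaStar (N : ℕ) (β : ℝ) : ℝ := max (4 * β - 2 - N / 2) (-(1 - β) * N)

/-- `q*(α,β) = 2(α - 4β + N)/(N - 4)`. -/
def qStar (N : ℕ) (α β : ℝ) : ℝ := 2 * (α - 4 * β + N) / (N - 4)

end

/-! The core is a pointwise bound: a radial $u\in D^{2,2}$ with $\|\Delta u\|_2\le1$ satisfies
$|u(x)|\le C|x|^{-\nu}$, $\nu=(N-4)/2$ (`exists_radial_decay`). Given this, near the origin
$K\le\Lambda|x|^{\alpha_0}V^{\beta_0}$. Of the $q_1$ powers of $u,h$, spend $2\beta_0$ together with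
$V^{\beta_0}$ on the potential energies, both at most 1, and bound the other $e=q_1-2\beta_0$ by the
decay (`rpow_mul_le_of_le`). Hölder leaves the weight $|x|^{\alpha_0-\nu e}$ with exponent
$1-\beta_0$. The condition $q_1<q^*$ says exactly that this weight has room to spare, which yields a
positive power of $R$.

The decay is proved by duality, with no differentiation of the radial profile. A bump $\psi(|x|)$
near radius $\rho$ is the Laplacian of an explicit potential, which outside the bump is a multiple
of $|x|^{2-N}$ determined by the mass alone (`exists_radial_potential`). The potential is not
compactly supported, so that of a bump of equal mass dilated by $L$ is subtracted: the tails cancel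
and the difference is an admissible test function. Cauchy-Schwarz bounds the $\Delta u$ term by a
multiple of $\rho^{-\nu}$ uniformly in $L$, while the far bump contributes nothing as $L\to\infty$
because $u\in L^{2^{**}}$ (`MemD22.abs_integral_mul_radial_le`). Shrinking bumps and Lebesgue
differentiation turn this into an almost everywhere bound (`abs_le_of_forall_bump`). -/

/-! ### Radial solutions of $\Delta\varphi=\psi(|x|)$ -/

/-- The primitive of a smooth function is smooth. -/
theorem contDiff_infty_of_hasDerivAt {f f' : ℝ → ℝ} (h : ∀ x, HasDerivAt f (f' x) x)
    (hf' : ContDiff ℝ ((⊤ : ℕ∞) : WithTop ℕ∞) f') : ContDiff ℝ ((⊤ : ℕ∞) : WithTop ℕ∞) f := by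
  rw [contDiff_infty_iff_deriv]
  refine ⟨fun x => (h x).differentiableAt, ?_⟩
  rwa [funext fun x => (h x).deriv]

theorem hasDerivAt_inv_sqrt_pow (n : ℕ) {s : ℝ} (hs : 0 < s) :
    HasDerivAt (fun s => (√s ^ n)⁻¹) (-(n / 2 * (√s ^ (n + 2))⁻¹)) s := by
  have h0 : √s ≠ 0 := (Real.sqrt_pos.2 hs).ne'
  have h := ((Real.hasDerivAt_sqrt hs.ne').pow n).inv (pow_ne_zero n h0)
  refine (show HasDerivAt (fun s => (√s ^ n)⁻¹) _ s from h).congr_deriv ?_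
  simp only [Pi.pow_apply]
  rcases n with _ | n
  · simp
  · simp only [Nat.add_sub_cancel]
    field_simp
    ring

/-- A solution `g` of `4 s g'' + 2 (n + 2) g' = ψ(√s)`, which is the equation `Δφ = ψ(|x|)` for
`φ(x) = g(|x|²)` on `ℝⁿ⁺²`. -/
theorem exists_radial_profile {n : ℕ} (hn : 0 < n) {ψ : ℝ → ℝ}
    (hψ : ContDiff ℝ ((⊤ : ℕ∞) : WithTop ℕ∞) ψ) (hψ0 : ∀ r, 0 ≤ ψ r) {c d : ℝ} (hc : 0 < c)
    (hcd : c ≤ d) (hsupp : ∀ r, r ∉ Ioo c d → ψ r = 0) :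
    ∃ g k k' : ℝ → ℝ, ContDiff ℝ ((⊤ : ℕ∞) : WithTop ℕ∞) g ∧ (∀ s, HasDerivAt g (k s) s) ∧
      (∀ s, HasDerivAt k (k' s) s) ∧
      (∀ s, 0 ≤ s → 4 * s * k' s + 2 * (n + 2) * k s = ψ √s) ∧
      (∀ s, d ^ 2 ≤ s → g s = -((∫ t in (0)..d, t ^ (n + 1) * ψ t) / n * (√s ^ n)⁻¹)) ∧
      ∀ s, |g s| ≤ (∫ t in (0)..d, t ^ (n + 1) * ψ t) / n * (max √s c ^ n)⁻¹ := by
  set m := ∫ t in (0)..d, t ^ (n + 1) * ψ t with hm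
  set w : ℝ → ℝ := fun t => t ^ (n + 1) * ψ t with hw
  have hd : 0 < d := hc.trans_le hcd
  have hwC : ContDiff ℝ ((⊤ : ℕ∞) : WithTop ℕ∞) w := (contDiff_id.pow _).mul hψ
  have hwc : Continuous w := hwC.continuous
  have hwi : ∀ a b, IntervalIntegrable w volume a b := fun a b => hwc.intervalIntegrable a b
  have hw0 : ∀ t, 0 ≤ w t := fun t => by
    by_cases ht : t ∈ Ioo c d
    · exact mul_nonneg (pow_nonneg (hc.le.trans ht.1.le) _) (hψ0 t)
    · simp [hw, hsupp t ht]
  have hwz : ∀ t, t ∉ Ioo c d → w t = 0 := fun t ht => by simp [hw, hsupp t ht]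
  set P : ℝ → ℝ := fun r => ∫ t in (0)..r, w t with hP
  have hPd : ∀ r, HasDerivAt P (w r) r := fun r =>
    intervalIntegral.integral_hasDerivAt_right (hwi _ _)
      (hwc.stronglyMeasurableAtFilter _ _) hwc.continuousAt
  have hPC : ContDiff ℝ ((⊤ : ℕ∞) : WithTop ℕ∞) P := contDiff_infty_of_hasDerivAt hPd hwC
  have hPmono : Monotone P := monotone_of_deriv_nonneg (fun r => (hPd r).differentiableAt)
    fun r => by rw [(hPd r).deriv]; exact hw0 r
  have hP0 : P 0 = 0 := by simp [hP]
  have hPm : P d = m := rfl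
  have hPc : ∀ r, 0 ≤ r → r ≤ c → P r = 0 := fun r hr hrc => by
    have : ∫ t in (0)..r, w t = ∫ t in (0)..r, (0 : ℝ) := by
      apply intervalIntegral.integral_congr
      intro t ht
      rw [uIcc_of_le hr] at ht
      exact hwz t fun h => absurd (ht.2.trans hrc) (not_le.2 h.1)
    simpa [hP] using this
  have hPd' : ∀ r, d ≤ r → P r = m := fun r hr => by
    have : ∫ t in d..r, w t = ∫ t in d..r, (0 : ℝ) := by
      apply intervalIntegral.integral_congr
      intro t ht
      rw [uIcc_of_le hr] at ht
      exact hwz t fun h => absurd ht.1 (not_le.2 h.2)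
    have h2 := intervalIntegral.integral_add_adjacent_intervals (hwi 0 d) (hwi d r)
    rw [this] at h2
    simpa [hP, hm] using h2.symm
  have hPle : ∀ r, P r ≤ m := fun r => by
    rcases le_total r d with h | h
    · exact hPmono h
    · exact (hPd' r h).le
  have hPnn : ∀ r, 0 ≤ r → 0 ≤ P r := fun r hr => hP0 ▸ hPmono hr
  have hm0 : 0 ≤ m := hPnn d hd.le
  -- With $r=\sqrt s$, the equation for $k=g'$ reads $(r^{n+2}k)'=\tfrac12r^{n+1}\psi(r)$, so $k$ is
  -- a primitive over an integrating factor.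
  set k : ℝ → ℝ := fun s => 1 / 2 * (√s ^ (n + 2))⁻¹ * P √s with hk
  have hsq : ∀ s, s < c ^ 2 → √s < c := fun s hs => (Real.sqrt_lt' hc).2 hs
  -- This covers negative $s$ too, where `√s` is 0; hence $k$ is smooth across the singularity of
  -- the square root.
  have hkz : ∀ s, s ≤ c ^ 2 → k s = 0 := fun s hs => by
    have : √s ≤ c := Real.sqrt_le_iff.2 ⟨hc.le, hs⟩
    simp [hk, hPc _ (Real.sqrt_nonneg s) this]
  have hkev : ∀ s, s < c ^ 2 → k =ᶠ[𝓝 s] fun _ => 0 := fun s hs => by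
    filter_upwards [Iio_mem_nhds hs] with t ht using hkz t (le_of_lt ht)
  have hkC : ContDiff ℝ ((⊤ : ℕ∞) : WithTop ℕ∞) k := by
    rw [contDiff_iff_contDiffAt]
    intro s
    by_cases hs : s < c ^ 2
    · exact contDiffAt_const.congr_of_eventuallyEq (hkev s hs)
    · have hs0 : 0 < s := (pow_pos hc 2).trans_le (not_lt.1 hs)
      have h1 : ContDiffAt ℝ ((⊤ : ℕ∞) : WithTop ℕ∞) (fun s => √s) s :=
        Real.contDiffAt_sqrt hs0.ne'
      exact (contDiffAt_const.mul ((h1.pow _).inv (pow_ne_zero _ (Real.sqrt_pos.2 hs0).ne'))).mul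
        (hPC.contDiffAt.comp s h1)
  have hkc : Continuous k := hkC.continuous
  have hki : ∀ a b, IntervalIntegrable k volume a b := fun a b => hkc.intervalIntegrable a b
  have hk0 : ∀ s, 0 ≤ k s := fun s => by
    have := hPnn _ (Real.sqrt_nonneg s)
    simp only [hk]; positivity
  have hkle : ∀ s, k s ≤ 1 / 2 * (√s ^ (n + 2))⁻¹ * m := fun s => by
    simp only [hk]
    gcongr
    exact hPle _
  have hn' : (n : ℝ) ≠ 0 := by exact_mod_cast hn.ne'
  have hHd : ∀ s, 0 < s →
      HasDerivAt (fun s => -(m / n * (√s ^ n)⁻¹)) (1 / 2 * (√s ^ (n + 2))⁻¹ * m) s := fun s hs => by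
    refine (show HasDerivAt (fun s => -(m / n * (√s ^ n)⁻¹)) _ s from
      ((hasDerivAt_inv_sqrt_pow n hs).const_mul (m / n)).neg).congr_deriv ?_
    field_simp
  -- The constant makes $g$ vanish at infinity.
  set g : ℝ → ℝ := fun s => (∫ t in (d ^ 2)..s, k t) - m / n * (d ^ n)⁻¹ with hg
  have hgd : ∀ s, HasDerivAt g (k s) s := fun s =>
    (intervalIntegral.integral_hasDerivAt_right (hki _ _)
      (hkc.stronglyMeasurableAtFilter _ _) hkc.continuousAt).sub_const _
  have hgC : ContDiff ℝ ((⊤ : ℕ∞) : WithTop ℕ∞) g := contDiff_infty_of_hasDerivAt hgd hkC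
  have hgmono : Monotone g := monotone_of_deriv_nonneg (fun r => (hgd r).differentiableAt)
    fun r => by rw [(hgd r).deriv]; exact hk0 r
  have hsd : √(d ^ 2) = d := Real.sqrt_sq hd.le
  have hg1 : ∀ s, d ^ 2 ≤ s → g s = -(m / n * (√s ^ n)⁻¹) := fun s hs => by
    have hpos : ∀ t ∈ uIcc (d ^ 2) s, 0 < t ∧ d ≤ √t := fun t ht => by
      rw [uIcc_of_le hs] at ht
      exact ⟨(pow_pos hd 2).trans_le ht.1, Real.le_sqrt_of_sq_le ht.1⟩
    have h := intervalIntegral.integral_eq_sub_of_hasDerivAt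
      (f := fun s => -(m / n * (√s ^ n)⁻¹)) (f' := k) (a := d ^ 2) (b := s)
      (fun t ht => by
        have := hHd t (hpos t ht).1
        simpa only [hk, hPd' _ (hpos t ht).2] using this) (hki _ _)
    simp only [hg, h, hsd]
    ring
  -- Inside the bump $k$ is at most the derivative of the pure tail; the two functions agree at
  -- $d^2$, so integrating backwards puts $g$ above the tail.
  have hg2 : ∀ s, 0 < s → s ≤ d ^ 2 → -(m / n * (√s ^ n)⁻¹) ≤ g s := fun s hs0 hs => by
    have hpos : ∀ t ∈ uIcc s (d ^ 2), 0 < t := fun t ht => by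
      rw [uIcc_of_le hs] at ht
      exact hs0.trans_le ht.1
    have hci : IntervalIntegrable (fun s => 1 / 2 * (√s ^ (n + 2))⁻¹ * m) volume s (d ^ 2) := by
      apply ContinuousOn.intervalIntegrable
      refine (continuousOn_const.mul (ContinuousOn.inv₀ (by fun_prop) ?_)).mul continuousOn_const
      exact fun t ht => pow_ne_zero _ (Real.sqrt_pos.2 (hpos t ht)).ne'
    have h := intervalIntegral.integral_eq_sub_of_hasDerivAt
      (f := fun s => -(m / n * (√s ^ n)⁻¹)) (a := s) (b := d ^ 2)
      (fun t ht => hHd t (hpos t ht)) hci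
    have h3 := intervalIntegral.integral_mono_on hs (hki _ _) hci fun t _ => hkle t
    rw [h] at h3
    simp only [hg, intervalIntegral.integral_symm s (d ^ 2)]
    rw [hsd] at h3
    linarith
  have hgneg : ∀ s, g s ≤ 0 := fun s => by
    have h1 := hgmono (le_max_left s (d ^ 2))
    rw [hg1 _ (le_max_right s (d ^ 2))] at h1
    refine h1.trans (neg_nonpos.2 ?_)
    positivity
  have hg3 : ∀ s, s ≤ c ^ 2 → g s = g (c ^ 2) := fun s hs => by
    have h : ∫ t in s..(c ^ 2), k t = ∫ t in s..(c ^ 2), (0 : ℝ) := by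
      apply intervalIntegral.integral_congr
      intro t ht
      rw [uIcc_of_le hs] at ht
      exact hkz t ht.2
    have h2 := intervalIntegral.integral_add_adjacent_intervals (hki (d ^ 2) s) (hki s (c ^ 2))
    rw [h] at h2
    simp only [hg, ← h2]
    simp
  have hg4 : ∀ s, c ^ 2 ≤ s → |g s| ≤ m / n * (√s ^ n)⁻¹ := fun s hs => by
    have hs0 : 0 < s := (pow_pos hc 2).trans_le hs
    rw [abs_of_nonpos (hgneg s)]
    rcases le_total s (d ^ 2) with h | h
    · linarith [hg2 s hs0 h]
    · rw [hg1 s h, neg_neg]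
  refine ⟨g, k, deriv k, hgC, hgd,
    fun s => (hkC.differentiable (by simp)).differentiableAt.hasDerivAt, ?_, hg1, ?_⟩
  · intro s hs
    by_cases hsc : s < c ^ 2
    · rw [(hkev s hsc).deriv_eq, hkz s hsc.le, hsupp]
      · simp
      · exact fun h => absurd h.1 (not_lt.2 (hsq s hsc).le)
    · have hs0 : 0 < s := (pow_pos hc 2).trans_le (not_lt.1 hsc)
      have hr : 0 < √s := Real.sqrt_pos.2 hs0
      have hd1 : HasDerivAt k _ s := ((hasDerivAt_inv_sqrt_pow (n + 2) hs0).const_mul (1 / 2)).mul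
        ((hPd √s).comp s (Real.hasDerivAt_sqrt hs0.ne'))
      rw [hd1.deriv]
      simp only [hk, hw]
      have hss : s = √s ^ 2 := (Real.sq_sqrt hs0.le).symm
      generalize √s = r at *
      subst hss
      push_cast
      field_simp
      ring
  · intro s
    rcases le_total (c ^ 2) s with h | h
    · rw [max_eq_left (Real.le_sqrt_of_sq_le h)]
      exact hg4 s h
    · rw [max_eq_right (Real.sqrt_le_iff.2 ⟨hc.le, h⟩), hg3 s h]
      simpa [Real.sqrt_sq hc.le] using hg4 (c ^ 2) le_rfl

/-- The Hessian of `x ↦ g(|x|²)` on the diagonal. -/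
theorem iteratedFDeriv_two_comp_norm_sq {E : Type*} [NormedAddCommGroup E] [InnerProductSpace ℝ E]
    {g k k' : ℝ → ℝ} (hg : ∀ s, HasDerivAt g (k s) s) (hk : ∀ s, HasDerivAt k (k' s) s) (x v : E) :
    iteratedFDeriv ℝ 2 (fun x : E => g (‖x‖ ^ 2)) x ![v, v] =
      4 * k' (‖x‖ ^ 2) * inner ℝ x v ^ 2 + 2 * k (‖x‖ ^ 2) * ‖v‖ ^ 2 := by
  obtain ⟨B, hB⟩ : ∃ B : E →L[ℝ] E →L[ℝ] ℝ, ∀ x y, B x y = inner ℝ x y :=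
    ⟨innerSL ℝ, fun _ _ => rfl⟩
  have h1 : ∀ x : E, HasFDerivAt (fun x : E => ‖x‖ ^ 2) ((2 : ℝ) • B x) x := fun x => by
    convert! (hasStrictFDerivAt_norm_sq x).hasFDerivAt using 1
    ext y
    simp [hB, two_mul]
  have h2 : fderiv ℝ (fun x : E => g (‖x‖ ^ 2)) = fun x => k (‖x‖ ^ 2) • ((2 : ℝ) • B x) :=
    funext fun x => ((hg _).comp_hasFDerivAt x (h1 x)).fderiv
  have h3 : HasFDerivAt (fun x : E => (2 : ℝ) • B x) ((2 : ℝ) • B) x := ((2 : ℝ) • B).hasFDerivAt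
  have h4 := ((hk _).comp_hasFDerivAt x (h1 x)).smul h3
  rw [iteratedFDeriv_two_apply, h2, show fderiv ℝ (fun x : E => k (‖x‖ ^ 2) • (2 : ℝ) • B x) x = _
    from h4.fderiv]
  simp [hB]
  ring

/-- The solution of `Δφ = ψ(|x|)` on `ℝᴺ` that vanishes at infinity. -/
theorem exists_radial_potential {N : ℕ} (hN : 3 ≤ N) {ψ : ℝ → ℝ}
    (hψ : ContDiff ℝ ((⊤ : ℕ∞) : WithTop ℕ∞) ψ) (hψ0 : ∀ r, 0 ≤ ψ r) {c d : ℝ} (hc : 0 < c)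
    (hcd : c ≤ d) (hsupp : ∀ r, r ∉ Ioo c d → ψ r = 0) :
    ∃ φ : EuclideanSpace ℝ (Fin N) → ℝ, ContDiff ℝ ((⊤ : ℕ∞) : WithTop ℕ∞) φ ∧
      (∀ x, ∑ i, iteratedFDeriv ℝ 2 φ x ![EuclideanSpace.single i 1, EuclideanSpace.single i 1] =
        ψ ‖x‖) ∧
      (∀ x, d ≤ ‖x‖ →
        φ x = -((∫ t in (0)..d, t ^ (N - 1) * ψ t) / (N - 2) * (‖x‖ ^ (N - 2))⁻¹)) ∧
      ∀ x, |φ x| ≤ (∫ t in (0)..d, t ^ (N - 1) * ψ t) / (N - 2) * (max ‖x‖ c ^ (N - 2))⁻¹ := by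
  obtain ⟨n, rfl⟩ : ∃ n, N = n + 2 := ⟨N - 2, by omega⟩
  obtain ⟨g, k, k', hgC, hg, hk, heq, hout, hbd⟩ :=
    exists_radial_profile (n := n) (by omega) hψ hψ0 hc hcd hsupp
  have hcast : ((n + 2 : ℕ) : ℝ) - 2 = n := by push_cast; ring
  simp only [hcast, show n + 2 - 1 = n + 1 by omega, Nat.add_sub_cancel]
  refine ⟨fun x => g (‖x‖ ^ 2), hgC.comp (contDiff_norm_sq ℝ), fun x => ?_, fun x hx => ?_,
    fun x => ?_⟩
  · simp only [iteratedFDeriv_two_comp_norm_sq hg hk]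
    rw [Finset.sum_add_distrib, ← Finset.mul_sum]
    simp only [PiLp.norm_single, EuclideanSpace.inner_single_right]
    have := heq (‖x‖ ^ 2) (by positivity)
    rw [Real.sqrt_sq (norm_nonneg x)] at this
    rw [← this, EuclideanSpace.real_norm_sq_eq]
    simp
    ring
  · have := hout (‖x‖ ^ 2) (pow_le_pow_left₀ (hc.le.trans hcd) hx 2)
    rwa [Real.sqrt_sq (norm_nonneg x)] at this
  · have := hbd (‖x‖ ^ 2)
    rwa [Real.sqrt_sq (norm_nonneg x)] at this

/-! ### Null sets on the half line and in space -/

/-- A property holding almost everywhere on the half line holds for almost every norm. -/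
theorem ae_norm_of_ae_Ioi {E : Type*} [NormedAddCommGroup E] [NormedSpace ℝ E] [Nontrivial E]
    [MeasurableSpace E] [BorelSpace E] [FiniteDimensional ℝ E] (μ : Measure E) [μ.IsAddHaarMeasure]
    {p : ℝ → Prop} (h : ∀ᵐ r ∂volume.restrict (Ioi (0 : ℝ)), p r) : ∀ᵐ x ∂μ, p ‖x‖ := by
  -- The indicator of the bad set has zero integral in polar coordinates; no measurability of `p` is
  -- needed.
  set f : ℝ → ℝ := {r | ¬ p r}.indicator 1 with hf
  have h0 : (fun r : ℝ => r ^ (Module.finrank ℝ E - 1) • f r) =ᵐ[volume.restrict (Ioi (0 : ℝ))] 0 := by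
    filter_upwards [h] with r hr
    simp [hf, hr]
  have hi : Integrable (fun x : E => f ‖x‖) μ :=
    (integrable_fun_norm_addHaar μ).2 ((integrable_zero _ _ _).congr h0.symm)
  have hz := integral_fun_norm_addHaar μ f
  rw [integral_congr_ae h0] at hz
  simp only [Pi.zero_apply, integral_zero, smul_zero] at hz
  rw [integral_eq_zero_iff_of_nonneg (fun x => indicator_nonneg (by simp) _) hi] at hz
  filter_upwards [hz] with x hx
  by_contra hp
  simp [hp] at hx

theorem quasiMeasurePreserving_norm {E : Type*} [NormedAddCommGroup E] [NormedSpace ℝ E]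
    [Nontrivial E] [MeasurableSpace E] [BorelSpace E] [FiniteDimensional ℝ E] (μ : Measure E)
    [μ.IsAddHaarMeasure] :
    Measure.QuasiMeasurePreserving (fun x : E => ‖x‖) μ (volume.restrict (Ioi (0 : ℝ))) := by
  refine ⟨measurable_norm, Measure.AbsolutelyContinuous.mk fun s hs h0 => ?_⟩
  rw [Measure.map_apply measurable_norm hs]
  have := ae_norm_of_ae_Ioi μ (p := fun r => r ∉ s) (measure_eq_zero_iff_ae_notMem.1 h0)
  exact measure_eq_zero_iff_ae_notMem.2 this

/-! ### Testing the weak Laplacian -/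

theorem hasWeakSecondPartial_weakSecondPartial {N : ℕ} {i j : Fin N}
    {u : EuclideanSpace ℝ (Fin N) → ℝ} (h : ∃ w, HasWeakSecondPartial i j u w) :
    HasWeakSecondPartial i j u (weakSecondPartial i j u) := by
  rw [weakSecondPartial, dif_pos h]
  exact h.choose_spec

theorem MemD22.hasWeakSecondPartial {N : ℕ} {u : EuclideanSpace ℝ (Fin N) → ℝ} (hu : MemD22 u)
    (i j : Fin N) : HasWeakSecondPartial i j u (weakSecondPartial i j u) :=
  hasWeakSecondPartial_weakSecondPartial ((hu.2 i j).imp fun _ h => h.1)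

theorem MemD22.aestronglyMeasurable_weakLaplacian {N : ℕ} {u : EuclideanSpace ℝ (Fin N) → ℝ}
    (hu : MemD22 u) : AEStronglyMeasurable (weakLaplacian u) := by
  have : weakLaplacian u = fun x => ∑ i, weakSecondPartial i i u x := rfl
  rw [this]
  exact Finset.aestronglyMeasurable_fun_sum _ fun i _ =>
    (hu.hasWeakSecondPartial i i).2.1.aestronglyMeasurable

theorem MemD22.integral_mul_laplacian {N : ℕ} {u : EuclideanSpace ℝ (Fin N) → ℝ} (hu : MemD22 u)
    {φ : EuclideanSpace ℝ (Fin N) → ℝ} (hφ : ContDiff ℝ ((⊤ : ℕ∞) : WithTop ℕ∞) φ)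
    (hs : HasCompactSupport φ) :
    ∫ x, u x * ∑ i, iteratedFDeriv ℝ 2 φ x
        ![EuclideanSpace.single i 1, EuclideanSpace.single i 1] =
      ∫ x, weakLaplacian u x * φ x := by
  have hD : ∀ i : Fin N, Continuous fun x => iteratedFDeriv ℝ 2 φ x
      ![EuclideanSpace.single i (1 : ℝ), EuclideanSpace.single i 1] := fun i =>
    (ContinuousMultilinearMap.apply ℝ (fun _ => EuclideanSpace ℝ (Fin N)) ℝ
      ![EuclideanSpace.single i (1 : ℝ), EuclideanSpace.single i 1]).continuous.comp
      (hφ.continuous_iteratedFDeriv (WithTop.coe_le_coe.2 le_top))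
  have hDs : ∀ i : Fin N, HasCompactSupport fun x => iteratedFDeriv ℝ 2 φ x
      ![EuclideanSpace.single i (1 : ℝ), EuclideanSpace.single i 1] := fun i =>
    (hs.iteratedFDeriv 2).comp_left (g := fun T : ContinuousMultilinearMap ℝ
      (fun _ : Fin 2 => EuclideanSpace ℝ (Fin N)) ℝ =>
        T ![EuclideanSpace.single i (1 : ℝ), EuclideanSpace.single i 1]) rfl
  have h1 : ∀ i : Fin N, Integrable fun x => u x * iteratedFDeriv ℝ 2 φ x
      ![EuclideanSpace.single i 1, EuclideanSpace.single i 1] := fun i => by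
    simpa only [smul_eq_mul, mul_comm] using
      (hu.hasWeakSecondPartial i i).1.integrable_smul_left_of_hasCompactSupport (hD i) (hDs i)
  have h2 : ∀ i : Fin N, Integrable fun x => weakSecondPartial i i u x * φ x := fun i => by
    simpa only [smul_eq_mul, mul_comm] using
      (hu.hasWeakSecondPartial i i).2.1.integrable_smul_left_of_hasCompactSupport hφ.continuous hs
  simp only [weakLaplacian, Finset.mul_sum, Finset.sum_mul]
  rw [integral_finsetSum _ fun i _ => h1 i, integral_finsetSum _ fun i _ => h2 i]
  exact Finset.sum_congr rfl fun i _ => (hu.hasWeakSecondPartial i i).2.2 φ hφ hs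

/-! ### Size of the potentials and of the far bump -/

/-- The square decays like $|x|^{-2(N-2)}$, and $2(N-2)>N$ exactly when $N>4$. -/
theorem integrable_inv_max_norm_pow_sq {N : ℕ} (hN : 5 ≤ N) {c : ℝ} (hc : 0 < c) :
    Integrable fun x : EuclideanSpace ℝ (Fin N) => ((max ‖x‖ c ^ (N - 2))⁻¹) ^ 2 := by
  have h := (integrable_one_add_norm (μ := (volume : Measure (EuclideanSpace ℝ (Fin N))))
    (r := ((2 * (N - 2) : ℕ) : ℝ)) (by
      rw [finrank_euclideanSpace_fin]; exact_mod_cast (by omega : N < 2 * (N - 2)))).const_mul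
      (((1 + c) / c) ^ (2 * (N - 2)))
  refine h.mono' ?_ (Eventually.of_forall fun x => ?_)
  · refine Continuous.aestronglyMeasurable (((Continuous.pow (by fun_prop) _).inv₀ ?_).pow 2)
    exact fun x => pow_ne_zero _ (lt_max_of_lt_right hc).ne'
  · have hm : 0 < max ‖x‖ c := lt_max_of_lt_right hc
    have h1 : 1 + ‖x‖ ≤ (1 + c) / c * max ‖x‖ c := by
      have h2 := le_max_left ‖x‖ c
      have h3 := le_max_right ‖x‖ c
      rw [div_mul_eq_mul_div, le_div_iff₀ hc]
      nlinarith [norm_nonneg x]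
    have h0 : 0 < 1 + ‖x‖ := by positivity
    rw [Real.norm_of_nonneg (by positivity), Real.rpow_neg h0.le, Real.rpow_natCast, ← inv_pow,
      ← pow_mul, mul_comm (N - 2) 2, ← inv_pow, ← mul_pow]
    refine pow_le_pow_left₀ (by positivity) ?_ _
    rw [← div_eq_mul_inv, le_div_iff₀ h0, inv_mul_eq_div, div_le_iff₀ hm]
    exact h1

/-- Scaling $x=cy$ gives $c^{N-2(N-2)}=c^{-(N-4)}$; its square root is the source of the decay
exponent. -/
theorem integral_inv_max_norm_pow_sq {N : ℕ} (hN : 5 ≤ N) {c : ℝ} (hc : 0 < c) :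
    ∫ x : EuclideanSpace ℝ (Fin N), ((max ‖x‖ c ^ (N - 2))⁻¹) ^ 2 =
      (∫ x : EuclideanSpace ℝ (Fin N), ((max ‖x‖ 1 ^ (N - 2))⁻¹) ^ 2) / c ^ (N - 4) := by
  have h := Measure.integral_comp_smul (volume : Measure (EuclideanSpace ℝ (Fin N)))
    (fun x => ((max ‖x‖ c ^ (N - 2))⁻¹) ^ 2) c
  have h2 : ∀ x : EuclideanSpace ℝ (Fin N), ((max ‖c • x‖ c ^ (N - 2))⁻¹) ^ 2 =
      (c ^ (2 * (N - 2)))⁻¹ * ((max ‖x‖ 1 ^ (N - 2))⁻¹) ^ 2 := fun x => by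
    have : max ‖c • x‖ c = c * max ‖x‖ 1 := by
      rw [norm_smul, Real.norm_of_nonneg hc.le, mul_max_of_nonneg _ _ hc.le, mul_one]
    rw [this, mul_pow, mul_inv, mul_pow, inv_pow (c ^ _), ← pow_mul, mul_comm (N - 2) 2]
  simp only [h2, integral_const_mul, finrank_euclideanSpace_fin, smul_eq_mul] at h
  rw [abs_of_nonneg (by positivity)] at h
  have hp : c ^ (2 * (N - 2)) = c ^ N * c ^ (N - 4) := by rw [← pow_add]; congr 1; omega
  rw [hp] at h
  field_simp at h ⊢
  linarith

/-- By Hölder the integral is at most $\|u\|_p$ times the volume to the power $1-1/p$, so after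
division $L^{-N/p}$ remains, which tends to 0 since $p$ is finite. -/
theorem tendsto_inv_pow_mul_integral_ball {N : ℕ} {u : EuclideanSpace ℝ (Fin N) → ℝ} {p : ℝ≥0∞}
    (hN : N ≠ 0) (hp1 : 1 ≤ p) (hp : p ≠ ∞) (hu : MemLp u p) {d : ℝ} (hd : 0 < d) :
    Tendsto (fun L : ℝ => (L ^ N)⁻¹ * ∫ x in Metric.ball 0 (L * d), |u x|) atTop (𝓝 0) := by
  set v := volume.real (Metric.ball (0 : EuclideanSpace ℝ (Fin N)) 1)
  set U := (eLpNorm u p).toReal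
  have hp0 : 0 < p.toReal := ENNReal.toReal_pos (by rintro rfl; simp at hp1) hp
  set θ := 1 / p.toReal
  have hθ : 0 < θ := by positivity
  have hθ1 : 0 ≤ 1 - θ := sub_nonneg.2 <| (div_le_one hp0).2 <| by
    simpa using ENNReal.toReal_mono hp hp1
  have hlim : Tendsto (fun L : ℝ => U * (d ^ N * v) ^ (1 - θ) * (L ^ N) ^ (-θ)) atTop (𝓝 0) := by
    have := ((tendsto_rpow_neg_atTop hθ).comp (tendsto_pow_atTop (α := ℝ) hN)).const_mul
      (U * (d ^ N * v) ^ (1 - θ))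
    simpa using this
  refine squeeze_zero' ?_ ?_ hlim
  · filter_upwards [eventually_gt_atTop 0] with L hL
    exact mul_nonneg (by positivity) (integral_nonneg fun x => abs_nonneg _)
  · filter_upwards [eventually_gt_atTop 0] with L hL
    set B := Metric.ball (0 : EuclideanSpace ℝ (Fin N)) (L * d)
    have hvB : (volume.restrict B) univ = ENNReal.ofReal (L ^ N * (d ^ N * v)) := by
      rw [Measure.restrict_apply_univ, Measure.addHaar_ball_of_pos _ _ (by positivity),
        finrank_euclideanSpace_fin, mul_pow, ← mul_assoc, ENNReal.ofReal_mul (by positivity)]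
      rw [ENNReal.ofReal_mul (p := L ^ N * d ^ N) (by positivity),
        ENNReal.ofReal_mul (p := L ^ N) (by positivity), ofReal_measureReal]
    have h1 := eLpNorm_le_eLpNorm_mul_rpow_measure_univ hp1
      (hu.1.mono_measure (Measure.restrict_le_self (s := B)))
    have h2 : eLpNorm u 1 (volume.restrict B) ≤
        ENNReal.ofReal (U * (L ^ N * (d ^ N * v)) ^ (1 - θ)) := by
      refine h1.trans ?_
      rw [hvB, ENNReal.toReal_one, div_one, ENNReal.ofReal_mul (p := U) (by positivity),
        ENNReal.ofReal_toReal hu.2.ne, ← ENNReal.ofReal_rpow_of_nonneg (by positivity) hθ1]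
      gcongr
      exact Measure.restrict_le_self
    have h3 : ∫ x in B, |u x| ≤ U * (L ^ N * (d ^ N * v)) ^ (1 - θ) := by
      rw [eLpNorm_one_eq_lintegral_enorm] at h2
      have : ∫ x in B, |u x| = (∫⁻ x in B, ‖u x‖ₑ).toReal :=
        integral_norm_eq_lintegral_enorm hu.1.restrict
      rw [this]
      exact ENNReal.toReal_le_of_le_ofReal (by positivity) h2
    calc (L ^ N)⁻¹ * ∫ x in B, |u x|
        ≤ (L ^ N)⁻¹ * (U * (L ^ N * (d ^ N * v)) ^ (1 - θ)) := by gcongr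
      _ = _ := by
        have hLN : 0 < L ^ N := by positivity
        rw [Real.mul_rpow hLN.le (by positivity), Real.rpow_sub hLN 1 θ, Real.rpow_one,
          Real.rpow_neg hLN.le]
        field_simp

/-- Cauchy-Schwarz against a majorant: the $L^2$ norm of $\Phi$ is explicit, while `φ` will depend
on the dilation parameter. -/
theorem abs_integral_mul_le_sqrt {α : Type*} [MeasurableSpace α] {μ : Measure α} {f φ Φ : α → ℝ}
    (hf : AEStronglyMeasurable f μ) (hf1 : ∫⁻ x, ‖f x‖ₑ ^ 2 ∂μ ≤ 1)
    (hΦ : AEStronglyMeasurable Φ μ) (hΦ2 : Integrable (fun x => Φ x ^ 2) μ)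
    (hle : ∀ x, |φ x| ≤ Φ x) : |∫ x, f x * φ x ∂μ| ≤ √(∫ x, Φ x ^ 2 ∂μ) := by
  have hΦL : MemLp Φ 2 μ := (memLp_two_iff_integrable_sq hΦ).2 hΦ2
  have hf1' : ∫⁻ x, ‖f x‖ₑ ^ (2 : ℝ) ∂μ ≤ 1 := by simpa using hf1
  have hfL : MemLp f 2 μ := ⟨hf, (eLpNorm_lt_top_iff_lintegral_rpow_enorm_lt_top (by simp)
    (by simp)).2 (by simpa using hf1'.trans_lt ENNReal.one_lt_top)⟩
  have h0 : ∀ x, 0 ≤ Φ x := fun x => (abs_nonneg _).trans (hle x)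
  have hf2 : ∫ x, ‖f x‖ ^ (2 : ℝ) ∂μ ≤ 1 := by
    rw [integral_eq_lintegral_of_nonneg_ae (Eventually.of_forall fun x => by positivity)
      (by simpa using! hf.pow 2)]
    refine ENNReal.toReal_le_of_le_ofReal zero_le_one ?_
    rw [ENNReal.ofReal_one]
    refine le_trans (le_of_eq (lintegral_congr fun x => ?_)) hf1'
    rw [← ofReal_norm, ENNReal.ofReal_rpow_of_nonneg (norm_nonneg _) (by norm_num)]
  calc |∫ x, f x * φ x ∂μ| ≤ ∫ x, ‖f x‖ * ‖Φ x‖ ∂μ := by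
        refine norm_integral_le_of_norm_le (f := fun x => f x * φ x) ?_ (Eventually.of_forall fun x => ?_)
        · exact hfL.norm.integrable_mul hΦL.norm
        · rw [norm_mul]
          gcongr
          exact (hle x).trans (le_abs_self _)
    _ ≤ (∫ x, ‖f x‖ ^ (2 : ℝ) ∂μ) ^ (1 / (2 : ℝ)) * (∫ x, ‖Φ x‖ ^ (2 : ℝ) ∂μ) ^ (1 / (2 : ℝ)) :=
        integral_mul_norm_le_Lp_mul_Lq Real.HolderConjugate.two_two (by simpa using hfL)
          (by simpa using hΦL)
    _ ≤ 1 * (∫ x, Φ x ^ 2 ∂μ) ^ (1 / (2 : ℝ)) := by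
        have h1 : 0 ≤ ∫ x, ‖f x‖ ^ (2 : ℝ) ∂μ := integral_nonneg fun x => by positivity
        have h2 : 0 ≤ ∫ x, Φ x ^ 2 ∂μ := integral_nonneg fun x => by positivity
        have h3 : ∫ x, ‖Φ x‖ ^ (2 : ℝ) ∂μ = ∫ x, Φ x ^ 2 ∂μ := by simp
        rw [h3]
        gcongr
        exact Real.rpow_le_one h1 hf2 (by norm_num)
    _ = _ := by rw [one_mul, Real.sqrt_eq_rpow]

theorem MemD22.locallyIntegrable {N : ℕ} (hN : N ≠ 0) {u : EuclideanSpace ℝ (Fin N) → ℝ}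
    (hu : MemD22 u) : LocallyIntegrable u := by
  have : NeZero N := ⟨hN⟩
  exact (hu.hasWeakSecondPartial 0 0).1

theorem one_le_critExponent {N : ℕ} (hN : 5 ≤ N) : 1 ≤ critExponent N := by
  have : (5 : ℝ) ≤ N := by exact_mod_cast hN
  rw [critExponent, ← ENNReal.ofReal_one]
  refine ENNReal.ofReal_le_ofReal ?_
  rw [le_div_iff₀ (by linarith)]
  linarith

/-! ### Pointwise decay of radial functions -/

/-- Testing a function of `D^{2,2}` against a radial bump. -/
theorem MemD22.abs_integral_mul_radial_le {N : ℕ} (hN : 5 ≤ N)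
    {u : EuclideanSpace ℝ (Fin N) → ℝ} (hu : MemD22 u)
    (hΔ : ∫⁻ x, ‖weakLaplacian u x‖ₑ ^ 2 ≤ 1) {ψ : ℝ → ℝ}
    (hψ : ContDiff ℝ ((⊤ : ℕ∞) : WithTop ℕ∞) ψ) (hψ0 : ∀ r, 0 ≤ ψ r) {c d : ℝ} (hc : 0 < c)
    (hcd : c ≤ d) (hsupp : ∀ r, r ∉ Ioo c d → ψ r = 0) :
    |∫ x, u x * ψ ‖x‖| ≤ 2 * ((∫ t in (0)..d, t ^ (N - 1) * ψ t) / (N - 2)) *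
      √((∫ x : EuclideanSpace ℝ (Fin N), ((max ‖x‖ 1 ^ (N - 2))⁻¹) ^ 2) / c ^ (N - 4)) := by
  have hd : 0 < d := hc.trans_le hcd
  have hul : LocallyIntegrable u := hu.locallyIntegrable (by omega)
  set m := ∫ t in (0)..d, t ^ (N - 1) * ψ t
  set A := m / (N - 2) with hA_def
  obtain ⟨M, hM⟩ : ∃ M, ∀ r, ψ r ≤ M := by
    have hcs : HasCompactSupport ψ := HasCompactSupport.intro (isCompact_Icc (a := c) (b := d))
      fun r hr => hsupp r fun h => hr (Ioo_subset_Icc_self h)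
    obtain ⟨M, hM⟩ := hcs.exists_bound_of_continuous hψ.continuous
    exact ⟨M, fun r => (le_abs_self _).trans (hM r)⟩
  obtain ⟨φ₁, hC₁, hΔ₁, hout₁, hbd₁⟩ :=
    exists_radial_potential (N := N) (by omega) hψ hψ0 hc hcd hsupp
  have hA : 0 ≤ A := by
    have h1 := (abs_nonneg _).trans (hbd₁ 0)
    exact nonneg_of_mul_nonneg_left h1 (inv_pos.2 (pow_pos (lt_max_of_lt_right hc) _))
  have hint : ∀ {ρ : ℝ → ℝ} {e : ℝ}, Continuous ρ → (∀ r, e ≤ r → ρ r = 0) →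
      Integrable fun x => u x * ρ ‖x‖ := fun {ρ e} hρ he => by
    have := hul.integrable_smul_left_of_hasCompactSupport (hρ.comp continuous_norm)
      (HasCompactSupport.intro (isCompact_closedBall (0 : EuclideanSpace ℝ (Fin N)) e)
        fun x hx => he _ (by simpa using le_of_lt (by simpa using hx)))
    simpa only [smul_eq_mul, mul_comm, Function.comp_apply] using this
  have key : ∀ L : ℝ, 1 ≤ L → |∫ x, u x * ψ ‖x‖| ≤
      2 * A * √((∫ x : EuclideanSpace ℝ (Fin N), ((max ‖x‖ 1 ^ (N - 2))⁻¹) ^ 2) / c ^ (N - 4)) +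
      M * ((L ^ N)⁻¹ * ∫ x in Metric.ball 0 (L * d), |u x|) := by
    intro L hL
    have hL0 : 0 < L := zero_lt_one.trans_le hL
    -- The factor $L^{-N}$ preserves the mass $\int t^{N-1}\psi$, hence the tail of the potential.
    set ψL : ℝ → ℝ := fun r => (L ^ N)⁻¹ * ψ (r / L) with hψL
    have hψLC : ContDiff ℝ ((⊤ : ℕ∞) : WithTop ℕ∞) ψL :=
      contDiff_const.mul (hψ.comp (contDiff_id.div_const L))
    have hψL0 : ∀ r, 0 ≤ ψL r := fun r => mul_nonneg (by positivity) (hψ0 _)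
    have hψLs : ∀ r, r ∉ Ioo (L * c) (L * d) → ψL r = 0 := fun r hr => by
      simp only [hψL]
      rw [hsupp, mul_zero]
      rintro ⟨h1, h2⟩
      rw [lt_div_iff₀' hL0] at h1
      rw [div_lt_iff₀' hL0] at h2
      exact hr ⟨h1, h2⟩
    have hmL : ∫ t in (0)..(L * d), t ^ (N - 1) * ψL t = m := by
      have h := intervalIntegral.integral_comp_div (a := 0) (b := L * d)
        (fun t => t ^ (N - 1) * ψ t) hL0.ne'
      rw [zero_div, mul_div_cancel_left₀ _ hL0.ne'] at h
      have h2 : ∀ t, t ^ (N - 1) * ψL t = L⁻¹ * ((t / L) ^ (N - 1) * ψ (t / L)) := fun t => by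
        have hp : L ^ N = L ^ (N - 1) * L := by rw [← pow_succ]; congr 1; omega
        simp only [hψL, hp, div_pow]
        field_simp
      simp only [h2, intervalIntegral.integral_const_mul, h, smul_eq_mul]
      rw [← mul_assoc, inv_mul_cancel₀ hL0.ne', one_mul]
    obtain ⟨φ₂, hC₂, hΔ₂, hout₂, hbd₂⟩ := exists_radial_potential (N := N) (by omega) hψLC hψL0
      (mul_pos hL0 hc) (mul_le_mul_of_nonneg_left hcd hL0.le) hψLs
    rw [hmL] at hout₂ hbd₂
    have hdL : d ≤ L * d := le_mul_of_one_le_left hd.le hL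
    have hcL : c ≤ L * c := le_mul_of_one_le_left hc.le hL
    have hCS : HasCompactSupport (φ₁ - φ₂) := HasCompactSupport.intro
      (isCompact_closedBall (0 : EuclideanSpace ℝ (Fin N)) (L * d)) fun x hx => by
        have hx' : L * d ≤ ‖x‖ := le_of_lt (by simpa using hx)
        rw [Pi.sub_apply, hout₁ x (hdL.trans hx'), hout₂ x hx']
        exact sub_self _
    have hid := hu.integral_mul_laplacian (φ := φ₁ - φ₂) (hC₁.sub hC₂) hCS
    have hsub : ∀ x, ∑ i, iteratedFDeriv ℝ 2 (φ₁ - φ₂) x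
        ![EuclideanSpace.single i 1, EuclideanSpace.single i 1] = ψ ‖x‖ - ψL ‖x‖ := fun x => by
      rw [← hΔ₁, ← hΔ₂, ← Finset.sum_sub_distrib]
      refine Finset.sum_congr rfl fun i _ => ?_
      rw [iteratedFDeriv_sub_apply (hC₁.contDiffAt.of_le (WithTop.coe_le_coe.2 le_top))
        (hC₂.contDiffAt.of_le (WithTop.coe_le_coe.2 le_top))]
      rfl
    simp only [hsub, mul_sub] at hid
    rw [integral_sub (hint (e := d) hψ.continuous fun r hr => hsupp r fun h => absurd h.2 hr.not_gt)
      (hint (e := L * d) hψLC.continuous fun r hr => hψLs r fun h => absurd h.2 hr.not_gt)] at hid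
    have hCS2 := abs_integral_mul_le_sqrt (φ := φ₁ - φ₂)
      (Φ := fun x : EuclideanSpace ℝ (Fin N) => 2 * A * (max ‖x‖ c ^ (N - 2))⁻¹)
      hu.aestronglyMeasurable_weakLaplacian hΔ
      (Continuous.aestronglyMeasurable <| continuous_const.mul
        ((Continuous.pow (by fun_prop) _).inv₀
          fun x => pow_ne_zero _ (lt_max_of_lt_right hc).ne'))
      (by simpa only [mul_pow] using (integrable_inv_max_norm_pow_sq hN hc).const_mul (2 ^ 2 * A ^ 2))
      (fun x => by
        -- The dilated potential is flatter, so one majorant serves both and the bound is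
        -- independent of $L$.
        have h3 : A * (max ‖x‖ (L * c) ^ (N - 2))⁻¹ ≤ A * (max ‖x‖ c ^ (N - 2))⁻¹ := by
          have : 0 < max ‖x‖ c := lt_max_of_lt_right hc
          gcongr
        have := (abs_sub (φ₁ x) (φ₂ x)).trans (add_le_add (hbd₁ x) ((hbd₂ x).trans h3))
        simp only [Pi.sub_apply]
        linarith)
    simp only [mul_pow _ (max _ _ ^ _)⁻¹, integral_const_mul,
      integral_inv_max_norm_pow_sq hN hc] at hCS2
    rw [Real.sqrt_mul (by positivity), Real.sqrt_sq (by positivity)] at hCS2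
    have hfar : |∫ x, u x * ψL ‖x‖| ≤ M * ((L ^ N)⁻¹ * ∫ x in Metric.ball 0 (L * d), |u x|) := by
      have hiB : IntegrableOn (fun x => |u x|)
          (Metric.ball (0 : EuclideanSpace ℝ (Fin N)) (L * d)) :=
        ((hul.integrableOn_isCompact (isCompact_closedBall 0 (L * d))).mono_set
          Metric.ball_subset_closedBall).abs
      rw [← mul_assoc, ← integral_const_mul, ← integral_indicator measurableSet_ball]
      refine norm_integral_le_of_norm_le (f := fun x => u x * ψL ‖x‖)
        ((integrable_indicator_iff measurableSet_ball).2 (hiB.const_mul _))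
        (Eventually.of_forall fun x => ?_)
      by_cases hx : x ∈ Metric.ball 0 (L * d)
      · rw [indicator_of_mem hx, norm_mul, Real.norm_of_nonneg (hψL0 _), Real.norm_eq_abs,
          mul_comm]
        gcongr
        simp only [hψL]
        rw [mul_comm]
        gcongr
        exact hM _
      · rw [indicator_of_notMem hx, hψLs]
        · simp
        · exact fun h => hx (by simpa using h.2)
    calc |∫ x, u x * ψ ‖x‖| = |(∫ x, weakLaplacian u x * (φ₁ - φ₂) x) + ∫ x, u x * ψL ‖x‖| := by
          rw [← hid]; ring_nf
      _ ≤ _ := (abs_add_le _ _).trans (add_le_add hCS2 hfar)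
  have hlim := ((tendsto_inv_pow_mul_integral_ball (by omega) (one_le_critExponent hN)
    ENNReal.ofReal_ne_top hu.1 hd).const_mul M).const_add (2 * A *
      √((∫ x : EuclideanSpace ℝ (Fin N), ((max ‖x‖ 1 ^ (N - 2))⁻¹) ^ 2) / c ^ (N - 4)))
  rw [mul_zero, add_zero] at hlim
  refine ge_of_tendsto hlim ?_
  filter_upwards [eventually_ge_atTop 1] with L hL using key L hL

/-- The pointwise estimate for a profile tested against bumps. -/
theorem abs_le_of_forall_bump {g : ℝ → ℝ} (hg : LocallyIntegrable g) {F : ℝ → ℝ}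
    (hF : ∀ ρ > 0, ∀ ψ : ℝ → ℝ, ContDiff ℝ ((⊤ : ℕ∞) : WithTop ℕ∞) ψ → (∀ r, 0 ≤ ψ r) →
      (∀ r, r ∉ Ioo (ρ / 2) (2 * ρ) → ψ r = 0) → ∫ r, ψ r = 1 → |∫ r, ψ r * g r| ≤ F ρ) :
    ∀ᵐ ρ, 0 < ρ → |g ρ| ≤ F ρ := by
  set φ : ℕ → ContDiffBump (0 : ℝ) := fun n =>
    ⟨1 / ((n : ℝ) + 1), 2 * (1 / ((n : ℝ) + 1)), by positivity, by
      have : 0 < 1 / ((n : ℝ) + 1) := by positivity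
      linarith⟩
  have hφ : Tendsto (fun n => (φ n).rOut) atTop (𝓝 0) := by
    have := (tendsto_one_div_add_atTop_nhds_zero_nat (𝕜 := ℝ)).const_mul 2
    rwa [mul_zero] at this
  have h := ContDiffBump.ae_convolution_tendsto_right_of_locallyIntegrable (μ := volume) (K := 2)
    hφ (Eventually.of_forall fun n => le_rfl) hg
  filter_upwards [h] with ρ hρ hρ0
  refine le_of_tendsto hρ.abs ?_
  -- Outer radius below $\rho/2$ keeps the translated bump inside $(\rho/2,2\rho)$.
  filter_upwards [hφ.eventually (gt_mem_nhds (half_pos hρ0))] with n hn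
  rw [convolution_eq_swap]
  simp only [ContinuousLinearMap.lsmul_apply, smul_eq_mul]
  refine hF ρ hρ0 (fun t => (φ n).normed volume (ρ - t)) ?_ ?_ ?_ ?_
  · exact (φ n).contDiff_normed.comp (contDiff_const.sub contDiff_id)
  · exact fun t => (φ n).nonneg_normed _
  · intro t ht
    rw [← Function.notMem_support, ContDiffBump.support_normed_eq]
    intro hm
    rw [mem_ball_zero_iff, Real.norm_eq_abs, abs_lt] at hm
    exact ht ⟨by linarith, by linarith⟩
  · rw [integral_sub_left_eq_self (fun t => (φ n).normed volume t)]
    exact (φ n).integral_normed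

/-- The polar weight $r^{N-1}$ gives integrability up to $r=0$, where `v` alone may fail to be
integrable; Lebesgue differentiation is therefore applied to the weighted profile. -/
theorem locallyIntegrable_radial_profile {N : ℕ} (hN : N ≠ 0) {v : ℝ → ℝ}
    (hv : LocallyIntegrable fun x : EuclideanSpace ℝ (Fin N) => v ‖x‖) :
    LocallyIntegrable ((Ioi (0 : ℝ)).indicator fun r => r ^ (N - 1) * v r) := by
  have : NeZero N := ⟨hN⟩
  rw [locallyIntegrable_iff]
  intro k hk
  obtain ⟨R, hR⟩ := hk.isBounded.subset_ball 0
  have h := (integrableOn_fun_norm_addHaar (volume : Measure (EuclideanSpace ℝ (Fin N)))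
    (f := v) (r := R)).1 ((hv.integrableOn_isCompact (isCompact_closedBall 0 R)).mono_set
      Metric.ball_subset_closedBall)
  rw [finrank_euclideanSpace_fin] at h
  rw [integrableOn_indicator_iff measurableSet_Ioi]
  refine h.mono_set fun r hr => ⟨hr.1, ?_⟩
  have := hR hr.2
  rw [mem_ball_zero_iff] at this
  exact (le_abs_self r).trans_lt this

/-- The radial lemma in `D^{2,2}`: `|u(x)| ≤ C |x|^{-(N-4)/2}` if `‖Δu‖₂ ≤ 1`. -/
theorem exists_radial_decay {N : ℕ} (hN : 5 ≤ N) :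
    ∃ C : ℝ, 0 ≤ C ∧ ∀ u : EuclideanSpace ℝ (Fin N) → ℝ, MemD22 u → IsRadial u →
      ∫⁻ x, ‖weakLaplacian u x‖ₑ ^ 2 ≤ 1 →
      ∀ᵐ x, 0 < ‖x‖ ∧ |u x| ≤ C * ‖x‖ ^ (-(((N : ℝ) - 4) / 2)) := by
  have : NeZero N := ⟨by omega⟩
  have hN2 : (0 : ℝ) < N - 2 := by
    have : (5 : ℝ) ≤ N := by exact_mod_cast hN
    linarith
  have hN0 : (0 : ℝ) < N := by linarith
  -- The area of the unit sphere.
  set b : ℝ := N * volume.real (Metric.ball (0 : EuclideanSpace ℝ (Fin N)) 1) with hb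
  have hb0 : 0 < b := mul_pos hN0
    (ENNReal.toReal_pos (Metric.measure_ball_pos _ _ one_pos).ne' measure_ball_lt_top.ne)
  set J := ∫ x : EuclideanSpace ℝ (Fin N), ((max ‖x‖ 1 ^ (N - 2))⁻¹) ^ 2
  have hJ : 0 ≤ J := integral_nonneg fun x => by positivity
  -- For a bump of unit integral in $(\rho/2,2\rho)$, the mass is at most $(2\rho)^{N-1}$ and the
  -- inner radius $c=\rho/2$ gives $2^{N-4}$; the other 2 counts the two potentials.
  set C := b⁻¹ * (2 * 2 ^ (N - 1) / (N - 2) * √(J * 2 ^ (N - 4)))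
  refine ⟨C, by positivity, fun u hu hrad hΔ => ?_⟩
  obtain ⟨v, hv⟩ := hrad
  have hvl : LocallyIntegrable fun x : EuclideanSpace ℝ (Fin N) => v ‖x‖ :=
    (hu.locallyIntegrable (by omega)).congr hv
  have hae := abs_le_of_forall_bump (locallyIntegrable_radial_profile (by omega) hvl)
    (F := fun ρ => C * ρ ^ (-(((N : ℝ) - 4) / 2)) * ρ ^ (N - 1)) (by
      intro ρ hρ ψ hψ hψ0 hψs hψ1
      have h1 := hu.abs_integral_mul_radial_le hN hΔ hψ hψ0 (half_pos hρ)
        (by linarith : ρ / 2 ≤ 2 * ρ) hψs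
      have h2 : ∫ x, u x * ψ ‖x‖ = b * ∫ r, ψ r *
          (Ioi (0 : ℝ)).indicator (fun r => r ^ (N - 1) * v r) r := by
        have h3 := integral_fun_norm_addHaar
          (volume : Measure (EuclideanSpace ℝ (Fin N))) (fun r => v r * ψ r)
        rw [finrank_euclideanSpace_fin] at h3
        have h4 : ∫ x, u x * ψ ‖x‖ = ∫ x : EuclideanSpace ℝ (Fin N), v ‖x‖ * ψ ‖x‖ :=
          integral_congr_ae (hv.mono fun x hx => by simp only [hx])
        rw [h4, h3, nsmul_eq_mul, smul_eq_mul, ← mul_assoc, ← integral_indicator measurableSet_Ioi]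
        congr 2
        ext r
        by_cases hr : r ∈ Ioi (0 : ℝ)
        · simp only [indicator_of_mem hr, smul_eq_mul]
          ring
        · simp only [indicator_of_notMem hr, mul_zero]
      have hm : ∫ t in (0)..(2 * ρ), t ^ (N - 1) * ψ t ≤ (2 * ρ) ^ (N - 1) := by
        have hψi : Integrable ψ := by
          -- A non-integrable function would have integral 0 by convention, not 1.
          by_contra h
          simp [integral_undef h] at hψ1
        rw [intervalIntegral.integral_of_le (by linarith)]
        calc ∫ t in Ioc 0 (2 * ρ), t ^ (N - 1) * ψ t
            ≤ ∫ t in Ioc 0 (2 * ρ), (2 * ρ) ^ (N - 1) * ψ t := by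
              refine setIntegral_mono_on ?_ (hψi.integrableOn.const_mul _) measurableSet_Ioc
                fun t ht => ?_
              · have : Continuous fun t => t ^ (N - 1) * ψ t :=
                  (continuous_pow _).mul hψ.continuous
                exact this.integrableOn_Ioc
              · have := ht.1.le
                have := ht.2
                have := hψ0 t
                gcongr
          _ = (2 * ρ) ^ (N - 1) * ∫ t in Ioc 0 (2 * ρ), ψ t := integral_const_mul _ _
          _ ≤ (2 * ρ) ^ (N - 1) * 1 := by
              gcongr
              rw [← hψ1]
              exact setIntegral_le_integral hψi (Eventually.of_forall hψ0)
          _ = _ := mul_one _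
      have hsq : √(J / (ρ / 2) ^ (N - 4)) = √(J * 2 ^ (N - 4)) * ρ ^ (-(((N : ℝ) - 4) / 2)) := by
        have hr : ρ ^ (-(((N : ℝ) - 4) / 2)) = √((ρ ^ (N - 4))⁻¹) := by
          rw [Real.sqrt_eq_rpow, ← Real.rpow_natCast, ← Real.rpow_neg hρ.le, ← Real.rpow_mul hρ.le,
            Nat.cast_sub (by omega)]
          congr 1
          push_cast
          ring
        rw [hr, ← Real.sqrt_mul (by positivity)]
        congr 1
        rw [div_pow]
        field_simp
      rw [h2, abs_mul, abs_of_pos hb0, hsq] at h1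
      rw [← mul_le_mul_iff_right₀ hb0]
      refine h1.trans ?_
      calc 2 * ((∫ t in (0)..(2 * ρ), t ^ (N - 1) * ψ t) / (N - 2)) *
            (√(J * 2 ^ (N - 4)) * ρ ^ (-(((N : ℝ) - 4) / 2)))
          ≤ 2 * ((2 * ρ) ^ (N - 1) / (N - 2)) *
            (√(J * 2 ^ (N - 4)) * ρ ^ (-(((N : ℝ) - 4) / 2))) := by gcongr
        _ = _ := by
          simp only [C, mul_pow]
          field_simp)
  have hae' := ae_norm_of_ae_Ioi (volume : Measure (EuclideanSpace ℝ (Fin N)))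
    (p := fun ρ => 0 < ρ ∧ |v ρ| ≤ C * ρ ^ (-(((N : ℝ) - 4) / 2))) (by
      filter_upwards [ae_restrict_of_ae hae, ae_restrict_mem measurableSet_Ioi] with ρ h1 hρ
      have hρ0 : (0 : ℝ) < ρ := hρ
      refine ⟨hρ0, ?_⟩
      have h2 := h1 hρ0
      rw [indicator_of_mem hρ, abs_mul, abs_of_pos (by positivity), mul_comm] at h2
      exact le_of_mul_le_mul_right h2 (by positivity))
  filter_upwards [hae', hv] with x h1 h2
  rwa [h2]

/-! ### Interpolation and the limit -/

theorem lintegral_ball_norm_rpow_lt_top {N : ℕ} (hN : N ≠ 0) {τ : ℝ} (hτ : -(N : ℝ) < τ) :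
    ∫⁻ x in Metric.ball (0 : EuclideanSpace ℝ (Fin N)) 1, ENNReal.ofReal (‖x‖ ^ τ) < ∞ := by
  have : NeZero N := ⟨hN⟩
  have h : IntegrableOn (fun x : EuclideanSpace ℝ (Fin N) => ‖x‖ ^ τ) (Metric.ball 0 1) := by
    rw [integrableOn_fun_norm_addHaar (volume : Measure (EuclideanSpace ℝ (Fin N)))
      (f := fun r => r ^ τ), finrank_euclideanSpace_fin]
    have hi := (intervalIntegral.intervalIntegrable_rpow' (a := 0) (b := 1)
      (by linarith : -1 < (N : ℝ) - 1 + τ)).1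
    refine ((hi.mono_set Ioo_subset_Ioc_self).congr_fun (fun r hr => ?_) measurableSet_Ioo)
    simp only [smul_eq_mul]
    rw [Real.rpow_add hr.1, ← Real.rpow_natCast, Nat.cast_sub (by omega), Nat.cast_one]
  exact h.lintegral_lt_top

/-- Interpolation of `V^β U^{q-1} H` between the potential energies of `U`, `H` and a bound for
both of them. -/
theorem rpow_mul_le_of_le {V U H D : ℝ≥0∞} (hU : U ≤ D) (hH : H ≤ D) {a b q : ℝ} (ha : 0 ≤ a)
    (hb : 0 ≤ b) (ha' : 2 * a ≤ 1) (hb' : 2 * b ≤ q - 1) :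
    V ^ (a + b) * (U ^ (q - 1) * H) ≤
      D ^ (q - 2 * (a + b)) * ((V * H ^ 2) ^ a * (V * U ^ 2) ^ b) := by
  have hsq : ∀ (X : ℝ≥0∞) (e : ℝ), (X ^ 2) ^ e = X ^ (2 * e) := fun X e => by
    rw [← ENNReal.rpow_two, ← ENNReal.rpow_mul]
  have h1 : H = H ^ (2 * a) * H ^ (1 - 2 * a) := by
    rw [← ENNReal.rpow_add_of_nonneg _ _ (by linarith) (by linarith), add_sub_cancel,
      ENNReal.rpow_one]
  have h2 : U ^ (q - 1) = U ^ (2 * b) * U ^ (q - 1 - 2 * b) := by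
    rw [← ENNReal.rpow_add_of_nonneg _ _ (by linarith) (by linarith), add_sub_cancel]
  have h3 : D ^ (q - 2 * (a + b)) = D ^ (1 - 2 * a) * D ^ (q - 1 - 2 * b) := by
    rw [← ENNReal.rpow_add_of_nonneg _ _ (by linarith) (by linarith)]
    congr 1
    ring
  calc V ^ (a + b) * (U ^ (q - 1) * H)
      = (H ^ (1 - 2 * a) * U ^ (q - 1 - 2 * b)) *
        ((V ^ a * H ^ (2 * a)) * (V ^ b * U ^ (2 * b))) := by
        rw [h2, ENNReal.rpow_add_of_nonneg _ _ ha hb]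
        nth_rw 1 [h1]
        ring
    _ ≤ (D ^ (1 - 2 * a) * D ^ (q - 1 - 2 * b)) *
        ((V ^ a * H ^ (2 * a)) * (V ^ b * U ^ (2 * b))) := by
        have : 0 ≤ 1 - 2 * a := by linarith
        have : 0 ≤ q - 1 - 2 * b := by linarith
        gcongr
    _ = _ := by
        rw [h3, ENNReal.mul_rpow_of_nonneg _ _ ha, ENNReal.mul_rpow_of_nonneg _ _ hb, hsq, hsq]

theorem lintegral_le_one_of_normH2V_eq_one {N : ℕ} {V : ℝ → ℝ≥0∞}
    {u : EuclideanSpace ℝ (Fin N) → ℝ} (h : normH2V V u = 1) :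
    ∫⁻ x, ‖weakLaplacian u x‖ₑ ^ 2 ≤ 1 ∧ ∫⁻ x, V ‖x‖ * ‖u x‖ₑ ^ 2 ≤ 1 := by
  have h1 : ∫⁻ x, (‖weakLaplacian u x‖ₑ ^ 2 + V ‖x‖ * ‖u x‖ₑ ^ 2) = 1 := by
    have := congrArg (fun y : ℝ≥0∞ => y ^ (2 : ℝ)) h
    simp only [normH2V, ← ENNReal.rpow_mul, ENNReal.one_rpow] at this
    rwa [one_div, inv_mul_cancel₀ two_ne_zero, ENNReal.rpow_one] at this
  exact ⟨h1 ▸ lintegral_mono fun x => le_self_add, h1 ▸ lintegral_mono fun x => le_add_self⟩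

/-- The total power $r^\gamma$ splits as $r^{\gamma-t\tau}(r^\tau)^t$: the first factor is at most
its value at $R$, the second is kept for Hölder. -/
theorem ofReal_mul_rpow_rpow_le {C r R α γ τ ν e t : ℝ} (hC : 0 ≤ C) (hr : 0 < r) (hrR : r ≤ R)
    (he : 0 ≤ e) (ht : 0 ≤ t) (hγ : γ = α - ν * e) (hσ : 0 ≤ γ - t * τ) :
    ENNReal.ofReal (r ^ α) * ENNReal.ofReal (C * r ^ (-ν)) ^ e ≤
      ENNReal.ofReal C ^ e * ENNReal.ofReal (R ^ (γ - t * τ)) * ENNReal.ofReal (r ^ τ) ^ t := by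
  rw [ENNReal.ofReal_rpow_of_nonneg (by positivity) he, ENNReal.ofReal_rpow_of_nonneg hC he,
    ENNReal.ofReal_rpow_of_nonneg (by positivity) ht, ← ENNReal.ofReal_mul (by positivity),
    ← ENNReal.ofReal_mul (by positivity),
    ← ENNReal.ofReal_mul (mul_nonneg (by positivity) (Real.rpow_nonneg (hr.le.trans hrR) _))]
  refine ENNReal.ofReal_le_ofReal ?_
  rw [Real.mul_rpow hC (by positivity), ← Real.rpow_mul hr.le, ← Real.rpow_mul hr.le]
  have h1 : r ^ α * r ^ (-ν * e) = r ^ (γ - t * τ) * r ^ (τ * t) := by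
    rw [← Real.rpow_add hr, ← Real.rpow_add hr, hγ]
    congr 1
    ring
  calc r ^ α * (C ^ e * r ^ (-ν * e)) = C ^ e * r ^ (γ - t * τ) * r ^ (τ * t) := by
        rw [mul_left_comm, h1, mul_assoc]
    _ ≤ _ := by gcongr

theorem theorem2 (N : ℕ) (hN : 5 ≤ N) (V : ℝ → ℝ≥0∞) (K : ℝ → ℝ)
    (hV : AssumptionV V) (hK : AssumptionK K)
    (R₁ : ℝ) (hR₁ : 0 < R₁)
    (hVfin : ∀ᵐ r ∂(volume.restrict (Ioo 0 R₁)), V r < ∞)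
    (α₀ β₀ : ℝ) (hβ₀ : 0 ≤ β₀) (hβ₁ : β₀ ≤ 1) (hα₀ : alphaStar N β₀ < α₀)
    (hess : essSup (fun r : ℝ => ENNReal.ofReal (K r) / (ENNReal.ofReal (r ^ α₀) * V r ^ β₀))
      (volume.restrict (Ioo 0 R₁)) < ∞)
    (q₁ : ℝ) (hq₁ : max 1 (2 * β₀) < q₁) (hq₁' : q₁ < qStar N α₀ β₀) :
    Tendsto (fun R : ℝ => calR0 N V K q₁ R) (𝓝[>] 0) (𝓝 0) := by
  have : NeZero N := ⟨by omega⟩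
  have hN5 : (5 : ℝ) ≤ N := by exact_mod_cast hN
  obtain ⟨hq1, hqβ⟩ := max_lt_iff.1 hq₁
  set Λ := essSup (fun r : ℝ => ENNReal.ofReal (K r) / (ENNReal.ofReal (r ^ α₀) * V r ^ β₀))
    (volume.restrict (Ioo 0 R₁))
  set ν : ℝ := ((N : ℝ) - 4) / 2 with hν
  set e : ℝ := q₁ - 2 * β₀ with he
  set γ : ℝ := α₀ - ν * e with hγ
  -- This quantity equals $\alpha_0-4\beta_0+N-\nu q_1$, so its positivity is the condition
  -- $q_1<q^*$.
  have hκ : 0 < γ + (1 - β₀) * N := by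
    rw [qStar, lt_div_iff₀ (by linarith)] at hq₁'
    simp only [hγ, hν, he]
    linarith
  set κ := γ + (1 - β₀) * N with hκ_def
  -- Half of the surplus `κ` makes $|x|^\tau$ integrable at 0; what is left is the positive power
  -- $(1+\beta_0)\kappa/2$ of $R$. This choice also covers $\beta_0=1$.
  set τ : ℝ := -N + κ / 2 with hτ
  have hσ : 0 < γ - (1 - β₀) * τ := by
    have : γ - (1 - β₀) * τ = (1 + β₀) * κ / 2 := by rw [hτ, hκ_def]; ring
    rw [this]
    positivity
  -- `h` occurs to the first power, so its energy can take an exponent of at most 1/2; the rest of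
  -- `β₀` falls on `u`, which has enough powers because $q_1>\max\{1,2\beta_0\}$.
  set a := min β₀ (1 / 2) with ha_def
  set b := β₀ - a with hb_def
  have hab : a + b = β₀ := add_sub_cancel _ _
  have ha : 0 ≤ a := le_min hβ₀ (by norm_num)
  have ha' : 2 * a ≤ 1 := by linarith [min_le_right β₀ (1 / 2)]
  have hb : 0 ≤ b := sub_nonneg.2 (min_le_left _ _)
  have hb' : 2 * b ≤ q₁ - 1 := by
    rcases le_total β₀ (1 / 2) with h | h
    · rw [hb_def, ha_def, min_eq_left h]
      linarith
    · rw [hb_def, ha_def, min_eq_right h]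
      linarith
  obtain ⟨C, hC, hdecay⟩ := exists_radial_decay hN
  set I := ∫⁻ x in Metric.ball (0 : EuclideanSpace ℝ (Fin N)) 1, ENNReal.ofReal (‖x‖ ^ τ)
  have hI : I < ∞ := lintegral_ball_norm_rpow_lt_top (by omega) (by linarith)
  have hKV : ∀ᵐ x : EuclideanSpace ℝ (Fin N), ‖x‖ ∈ Ioo 0 R₁ →
      ENNReal.ofReal (K ‖x‖) ≤ Λ * (ENNReal.ofReal (‖x‖ ^ α₀) * V ‖x‖ ^ β₀) := by
    refine ae_norm_of_ae_Ioi volume (p := fun r => r ∈ Ioo 0 R₁ →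
      ENNReal.ofReal (K r) ≤ Λ * (ENNReal.ofReal (r ^ α₀) * V r ^ β₀)) (ae_restrict_of_ae ?_)
    rw [← ae_restrict_iff' measurableSet_Ioo]
    filter_upwards [hVfin, ENNReal.ae_le_essSup fun r : ℝ =>
      ENNReal.ofReal (K r) / (ENNReal.ofReal (r ^ α₀) * V r ^ β₀)] with r h1 h2
    -- A vanishing denominator is harmless because $\Lambda<\infty$; an infinite one, where the
    -- quotient would be 0, is excluded by $V<\infty$.
    refine (ENNReal.div_le_iff_le_mul (Or.inr hess.ne) (Or.inl ?_)).1 h2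
    exact ENNReal.mul_ne_top ENNReal.ofReal_ne_top (ENNReal.rpow_ne_top_of_nonneg hβ₀ h1.ne)
  have hVm : AEMeasurable fun x : EuclideanSpace ℝ (Fin N) => V ‖x‖ :=
    hV.1.comp_quasiMeasurePreserving (quasiMeasurePreserving_norm volume)
  set Q := Λ * ENNReal.ofReal C ^ e * I ^ (1 - β₀) with hQ
  have hQ_top : Q ≠ ∞ := ENNReal.mul_ne_top (ENNReal.mul_ne_top hess.ne
    (ENNReal.rpow_ne_top_of_nonneg (by linarith) ENNReal.ofReal_ne_top))
    (ENNReal.rpow_ne_top_of_nonneg (by linarith) hI.ne)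
  have hbound : ∀ R, 0 < R → R < R₁ → R < 1 →
      calR0 N V K q₁ R ≤ Q * ENNReal.ofReal (R ^ (γ - (1 - β₀) * τ)) := by
    intro R hR hRR₁ hR1
    refine iSup_le fun u => iSup_le fun h => iSup_le fun ⟨hu, hh, hnu, hnh⟩ => ?_
    obtain ⟨hΔu, hVu⟩ := lintegral_le_one_of_normH2V_eq_one hnu
    obtain ⟨hΔh, hVh⟩ := lintegral_le_one_of_normH2V_eq_one hnh
    set B := Metric.ball (0 : EuclideanSpace ℝ (Fin N)) R
    have hpt : ∀ᵐ x ∂volume.restrict B,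
        ENNReal.ofReal (K ‖x‖) * ‖u x‖ₑ ^ (q₁ - 1) * ‖h x‖ₑ ≤
        (Λ * ENNReal.ofReal C ^ e * ENNReal.ofReal (R ^ (γ - (1 - β₀) * τ))) *
          (ENNReal.ofReal (‖x‖ ^ τ) ^ (1 - β₀) *
            (V ‖x‖ * ‖h x‖ₑ ^ 2) ^ a * (V ‖x‖ * ‖u x‖ₑ ^ 2) ^ b) := by
      filter_upwards [ae_restrict_of_ae hKV, ae_restrict_of_ae (hdecay u hu.1.1 hu.2 hΔu),
        ae_restrict_of_ae (hdecay h hh.1.1 hh.2 hΔh), ae_restrict_mem measurableSet_ball]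
        with x hKx hux hhx hxB
      have hxR : ‖x‖ < R := mem_ball_zero_iff.1 hxB
      set D := ENNReal.ofReal (C * ‖x‖ ^ (-ν))
      have hD : ∀ {y : ℝ}, |y| ≤ C * ‖x‖ ^ (-ν) → ‖y‖ₑ ≤ D := fun {y} hy => by
        rw [← ofReal_norm]
        exact ENNReal.ofReal_le_ofReal hy
      have h1 := rpow_mul_le_of_le (V := V ‖x‖) (hD hux.2) (hD hhx.2) ha hb ha' hb'
      have h2 := ofReal_mul_rpow_rpow_le (α := α₀) (e := e) hC hux.1 hxR.le (by linarith)
        (sub_nonneg.2 hβ₁) hγ hσ.le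
      rw [hab] at h1
      calc ENNReal.ofReal (K ‖x‖) * ‖u x‖ₑ ^ (q₁ - 1) * ‖h x‖ₑ
          ≤ Λ * (ENNReal.ofReal (‖x‖ ^ α₀) * V ‖x‖ ^ β₀) * ‖u x‖ₑ ^ (q₁ - 1) * ‖h x‖ₑ := by
            gcongr
            exact hKx ⟨hux.1, hxR.trans hRR₁⟩
        _ = Λ * ENNReal.ofReal (‖x‖ ^ α₀) *
            (V ‖x‖ ^ β₀ * (‖u x‖ₑ ^ (q₁ - 1) * ‖h x‖ₑ)) := by ring
        _ ≤ Λ * ENNReal.ofReal (‖x‖ ^ α₀) * (D ^ e *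
            ((V ‖x‖ * ‖h x‖ₑ ^ 2) ^ a * (V ‖x‖ * ‖u x‖ₑ ^ 2) ^ b)) := by gcongr
        _ = Λ * (ENNReal.ofReal (‖x‖ ^ α₀) * D ^ e) *
            ((V ‖x‖ * ‖h x‖ₑ ^ 2) ^ a * (V ‖x‖ * ‖u x‖ₑ ^ 2) ^ b) := by ring
        _ ≤ Λ * (ENNReal.ofReal C ^ e * ENNReal.ofReal (R ^ (γ - (1 - β₀) * τ)) *
              ENNReal.ofReal (‖x‖ ^ τ) ^ (1 - β₀)) *
            ((V ‖x‖ * ‖h x‖ₑ ^ 2) ^ a * (V ‖x‖ * ‖u x‖ₑ ^ 2) ^ b) := by gcongr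
        _ = _ := by ring
    have hmeas : ∀ {w : EuclideanSpace ℝ (Fin N) → ℝ}, MemH2Vr V w →
        AEMeasurable (fun x => V ‖x‖ * ‖w x‖ₑ ^ 2) (volume.restrict B) := fun hw =>
      (hVm.mul (hw.1.1.1.1.enorm.pow_const 2)).restrict
    -- Three-factor Hölder with exponents $1-\beta_0$, $a$, $b$, which sum to 1; a zero exponent is
    -- allowed, so the endpoint values of `β₀` need no separate case.
    have hHolder := ENNReal.lintegral_prod_norm_pow_le (μ := volume.restrict B) Finset.univ
      (f := ![fun x => ENNReal.ofReal (‖x‖ ^ τ), fun x => V ‖x‖ * ‖h x‖ₑ ^ 2,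
        fun x => V ‖x‖ * ‖u x‖ₑ ^ 2]) (p := ![1 - β₀, a, b])
      (by
        intro i _
        fin_cases i
        · exact (measurable_norm.pow_const τ).ennreal_ofReal.aemeasurable
        · exact hmeas hh
        · exact hmeas hu)
      (by simp [Fin.sum_univ_three]; linarith)
      (by
        intro i _
        fin_cases i
        · exact sub_nonneg.2 hβ₁
        · exact ha
        · exact hb)
    simp only [Fin.prod_univ_three, Matrix.cons_val_zero, Matrix.cons_val_one,
      Matrix.cons_val] at hHolder
    calc ∫⁻ x in B, ENNReal.ofReal (K ‖x‖) * ‖u x‖ₑ ^ (q₁ - 1) * ‖h x‖ₑ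
        ≤ _ := lintegral_mono_ae hpt
      _ = (Λ * ENNReal.ofReal C ^ e * ENNReal.ofReal (R ^ (γ - (1 - β₀) * τ))) * _ :=
          lintegral_const_mul' _ _ (ENNReal.mul_ne_top (ENNReal.mul_ne_top hess.ne
            (ENNReal.rpow_ne_top_of_nonneg (by linarith) ENNReal.ofReal_ne_top))
            ENNReal.ofReal_ne_top)
      _ ≤ (Λ * ENNReal.ofReal C ^ e * ENNReal.ofReal (R ^ (γ - (1 - β₀) * τ))) *
          (I ^ (1 - β₀) * 1 ^ a * 1 ^ b) := by
          refine mul_le_mul_right (hHolder.trans ?_) _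
          have h1β : 0 ≤ 1 - β₀ := sub_nonneg.2 hβ₁
          gcongr
          · exact lintegral_mono_set (Metric.ball_subset_ball hR1.le)
          · exact (setLIntegral_le_lintegral _ _).trans hVh
          · exact (setLIntegral_le_lintegral _ _).trans hVu
      _ = _ := by rw [ENNReal.one_rpow, ENNReal.one_rpow, hQ]; ring
  have hlim : Tendsto (fun R : ℝ => Q * ENNReal.ofReal (R ^ (γ - (1 - β₀) * τ)))
      (𝓝[>] 0) (𝓝 0) := by
    have h1 : Tendsto (fun R : ℝ => R ^ (γ - (1 - β₀) * τ)) (𝓝[>] 0) (𝓝 0) := by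
      have := (Real.continuousAt_rpow_const 0 _ (Or.inr hσ.le)).tendsto
      rw [Real.zero_rpow hσ.ne'] at this
      exact this.mono_left nhdsWithin_le_nhds
    have h2 := ENNReal.Tendsto.const_mul (a := Q) (ENNReal.tendsto_ofReal h1) (Or.inr hQ_top)
    simpa using h2
  refine tendsto_of_tendsto_of_tendsto_of_le_of_le' tendsto_const_nhds hlim
    (Eventually.of_forall fun R => zero_le) ?_
  filter_upwards [Ioo_mem_nhdsGT (lt_min hR₁ one_pos)] with R hR
  exact hbound R hR.1 (hR.2.trans_le (min_le_left _ _)) (hR.2.trans_le (min_le_right _ _))
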